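/- Let $k$ be a field, let $S = k[x_1,\ldots,x_n]$ with its standard $\mathbb{Z}^n$-grading (the variable $x_i$ has degree the $i$-th standard basis vector), and let $\mathfrak{m} = (x_1,\ldots,x_n)$. Let $M = \bigoplus_{\mathbf{b}\in\mathbb{Z}^n} M_{\mathbf{b}}$ be a finitely generated $\mathbb{Z}^n$-graded $S$-module, with Betti numbers $\beta_{i,\mathbf{b}}(M) = \dim_k \operatorname{Tor}_i^S(k,M)_{\mathbf{b}}$ for $i \ge 0$ and $\mathbf{b}\in\mathbb{Z}^n$. Let $\preceq$ denote the coordinatewise partial order on $\mathbb{Z}^n$, let $\mathbf{1} = (1,\ldots,1)$, and let $\mathbf{a}\in\mathbb{Z}^n$. If $\mathbf{b} \preceq \mathbf{a}$ whenever $\beta_{i,\mathbf{b}}(M) \neq 0$ for some $i$, then for every $i \ge 0$ the $\mathbb{Z}^n$-graded local cohomology module $H^i_{\mathfrak{m}}(M)$ (the $i$-th right derived functor, on $\mathbb{Z}^n$-graded modules, of the $\mathfrak{m}$-torsion functor $\Gamma_{\mathfrak{m}}$) can be nonzero only in degrees $\preceq \mathbf{a} - \mathbf{1}$; that is, $H^i_{\mathfrak{m}}(M)_{\mathbf{c}}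 \neq 0$ implies $\mathbf{c} \preceq \mathbf{a} - \mathbf{1}$. -/

import Mathlib

open CategoryTheory CategoryTheory.Limits

universe u

/-!
`S = k[x₁, …, xₙ]` is `MvPolynomial (Fin n) k`.  A `ℤⁿ`-graded `S`-module is an `S`-module `M` with
a decomposition `M = ⨁ M_b` into `k`-subspaces indexed by `b : Fin n → ℤ` such that
`S_c • M_b ⊆ M_{c+b}`.  The abelian category of `ℤⁿ`-graded `S`-modules and homogeneous maps of
degree `0` is presented by homogeneous components: such a module is the same thing as the family
of the vector spaces `M_b`, together with the multiplications by monomials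
`x^{c-b} : M_b → M_c` for `b ≤ c`, that is, a functor from the poset `ℤⁿ` to `k`-vector spaces.
-/

namespace MultiGraded

/-- The `ℤⁿ`-grading of `S = k[x₁, …, xₙ]`: the variable `xᵢ` has degree the `i`-th basis vector. -/
abbrev polyGrading (k : Type u) [Field k] (n : ℕ) :
    (Fin n → ℤ) → Submodule k (MvPolynomial (Fin n) k) :=
  MvPolynomial.weightedHomogeneousSubmodule k (fun i : Fin n => Pi.single i (1 : ℤ))

/-- The poset `ℤⁿ` of degrees, with the coordinatewise order `⪯`, regarded as a category with one
arrow `b ⟶ c` whenever `b ⪯ c`. -/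
def Deg (n : ℕ) : Type := Fin n → ℤ

instance (n : ℕ) : PartialOrder (Deg n) := inferInstanceAs (PartialOrder (Fin n → ℤ))

/-- The category of `ℤⁿ`-graded `k[x₁, …, xₙ]`-modules with homogeneous maps of degree `0`,
presented through homogeneous components and multiplications by monomials. -/
abbrev GrMod (k : Type u) [Field k] (n : ℕ) : Type (u + 1) :=
  Deg n ⥤ ModuleCat.{u} k

section Category

lemma projective_sigma {C β : Type*} [Category C] (P : β → C) [HasCoproduct P]
    (h : ∀ b, Projective (P b)) : Projective (∐ P) where
  factors f e _ := ⟨Sigma.desc fun b => Projective.factorThru (Sigma.ι P b ≫ f) e, by cat_disch⟩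

lemma injective_pi {C β : Type*} [Category C] (I : β → C) [HasProduct I]
    (h : ∀ b, Injective (I b)) : Injective (∏ᶜ I) where
  factors g f _ := ⟨Pi.lift fun b => Injective.factorThru (g ≫ Pi.π I b) f, by ext; simp⟩

variable (J : Type) [SmallCategory J] (A : Type (u + 1)) [Category.{u} A] [Abelian A]

lemma enoughProjectives_functor [HasColimitsOfSize.{0, 0} A] [EnoughProjectives A] :
    EnoughProjectives (J ⥤ A) where
  presentation N := by
    let P : J → (J ⥤ A) := fun b => (evaluationLeftAdjoint A b).obj (Projective.over (N.obj b))
    let f : ∀ b, P b ⟶ N := fun b =>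
      ((evaluationAdjunctionRight A b).homEquiv _ _).symm (Projective.π (N.obj b))
    have hP : ∀ b, Projective (P b) := fun b =>
      (evaluationAdjunctionRight A b).map_projective _ inferInstance
    have hepi : Epi (Sigma.desc f) := by
      rw [NatTrans.epi_iff_epi_app]
      intro b
      have h : (evaluationAdjunctionRight A b).unit.app _ ≫
          ((evaluation _ _).obj b).map (f b) = Projective.π (N.obj b) :=
        ((evaluationAdjunctionRight A b).homEquiv_unit _ _ _).symm.trans
          (Equiv.apply_symm_apply _ _)
      have h2 : (f b).app b = (Sigma.ι P b).app b ≫ (Sigma.desc f).app b := by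
        rw [← NatTrans.comp_app, Sigma.ι_desc]
      have h3 : ((evaluationAdjunctionRight A b).unit.app _ ≫
          (Sigma.ι P b).app b) ≫ (Sigma.desc f).app b = Projective.π (N.obj b) := by
        rw [Category.assoc]
        exact (congrArg _ h2.symm).trans h
      exact epi_of_epi_fac h3
    exact ⟨{ p := ∐ P, f := Sigma.desc f, projective := projective_sigma P hP, epi := hepi }⟩

lemma enoughInjectives_functor [HasLimitsOfSize.{0, 0} A] [EnoughInjectives A] :
    EnoughInjectives (J ⥤ A) where
  presentation N := by
    let I : J → (J ⥤ A) := fun b => (evaluationRightAdjoint A b).obj (Injective.under (N.obj b))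
    let f : ∀ b, N ⟶ I b := fun b =>
      (evaluationAdjunctionLeft A b).homEquiv _ _ (Injective.ι (N.obj b))
    have hI : ∀ b, Injective (I b) := fun b =>
      (evaluationAdjunctionLeft A b).map_injective _ inferInstance
    have hmono : Mono (Pi.lift f) := by
      rw [NatTrans.mono_iff_mono_app]
      intro b
      have h : ((evaluation _ _).obj b).map (f b) ≫
          (evaluationAdjunctionLeft A b).counit.app _ = Injective.ι (N.obj b) :=
        ((evaluationAdjunctionLeft A b).homEquiv_counit _ _ _).symm.trans
          (Equiv.symm_apply_apply _ _)
      have h2 : (f b).app b = (Pi.lift f).app b ≫ (Pi.π I b).app b := by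
        rw [← NatTrans.comp_app, Pi.lift_π]
      have h3 : (Pi.lift f).app b ≫ ((Pi.π I b).app b ≫
          (evaluationAdjunctionLeft A b).counit.app _) = Injective.ι (N.obj b) := by
        rw [← Category.assoc]
        exact (congrArg (· ≫ _) h2.symm).trans h
      exact mono_of_mono_fac h3
    exact ⟨{ J := ∏ᶜ I, f := Pi.lift f, injective := injective_pi I hI, mono := hmono }⟩

end Category

instance (k : Type u) [Field k] (n : ℕ) : EnoughProjectives (GrMod k n) :=
  enoughProjectives_functor _ _

instance (k : Type u) [Field k] (n : ℕ) : EnoughInjectives (GrMod k n) :=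
  enoughInjectives_functor _ _

section Reduction

variable {k : Type u} [Field k] {n : ℕ}

/-- The degree `b` component of `𝔪N`, where `𝔪 = (x₁, …, xₙ)`: the sum of the subspaces
`x^{b-c} N_c` over all `c < b`. -/
def maxIdealSMul (N : GrMod k n) (b : Deg n) : Submodule k (N.obj b) :=
  ⨆ (c : Deg n) (h : c < b), LinearMap.range (N.map (homOfLE h.le)).hom

lemma maxIdealSMul_le_map (N : GrMod k n) {b c : Deg n} (h : b ⟶ c) :
    maxIdealSMul N b ≤ (maxIdealSMul N c).comap (N.map h).hom := by
  refine iSup₂_le fun d hd => ?_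
  rintro _ ⟨y, rfl⟩
  have hdc : d < c := hd.trans_le (leOfHom h)
  refine (le_iSup₂_of_le (f := fun (c' : Deg n) (h' : c' < c) =>
    LinearMap.range (N.map (homOfLE h'.le)).hom) d hdc le_rfl) ⟨y, ?_⟩
  rw [← LinearMap.comp_apply, ← ModuleCat.hom_comp, ← N.map_comp]
  rfl

lemma maxIdealSMul_le_app {N N' : GrMod k n} (f : N ⟶ N') (b : Deg n) :
    maxIdealSMul N b ≤ (maxIdealSMul N' b).comap (f.app b).hom := by
  refine iSup₂_le fun d hd => ?_
  rintro _ ⟨y, rfl⟩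
  refine (le_iSup₂_of_le (f := fun (c' : Deg n) (h' : c' < b) =>
    LinearMap.range (N'.map (homOfLE h'.le)).hom) d hd le_rfl) ⟨(f.app d).hom y, ?_⟩
  rw [← LinearMap.comp_apply, ← ModuleCat.hom_comp, ← f.naturality]
  rfl

/-- The functor `N ↦ k ⊗_S N = N / 𝔪N` on `ℤⁿ`-graded `S`-modules, where `k = S / 𝔪`. -/
noncomputable def residueTensor (k : Type u) [Field k] (n : ℕ) : GrMod k n ⥤ GrMod k n where
  obj N :=
    { obj := fun b => ModuleCat.of k (N.obj b ⧸ maxIdealSMul N b)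
      map := fun h => ModuleCat.ofHom
        (Submodule.mapQ _ _ (N.map h).hom (maxIdealSMul_le_map N h))
      map_id := fun b => by
        ext x
        simp
      map_comp := fun g h => by
        ext x
        simp }
  map f :=
    { app := fun b => ModuleCat.ofHom
        (Submodule.mapQ _ _ (f.app b).hom (maxIdealSMul_le_app f b))
      naturality := fun b c h => by
        ext x
        simp }
  map_id N := by
    ext b x
    simp
  map_comp f g := by
    ext b x
    simp

instance residueTensor_additive (k : Type u) [Field k] (n : ℕ) : (residueTensor k n).Additive where
  map_add {N N' f g} := by
    ext b x
    obtain ⟨x, rfl⟩ := Submodule.Quotient.mk_surjective (maxIdealSMul N b) x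
    rfl

/-- The `ℤⁿ`-graded module `Tor_i^S(k, N)`. -/
noncomputable def torResidue (i : ℕ) (N : GrMod k n) : GrMod k n :=
  ((residueTensor k n).leftDerived i).obj N

end Reduction

section Torsion

variable {k : Type u} [Field k] {n : ℕ}

/-- The degree `b` component of `Γ_𝔪(N)`: the elements `y` of `N_b` with `𝔪ᵗ y = 0` for some `t`,
that is, the elements killed by all the monomials `x^{c-b}` of total degree at least `t`. -/
def torsionPart (N : GrMod k n) (b : Deg n) : Submodule k (N.obj b) where
  carrier := {y | ∃ t : ℕ, ∀ (c : Deg n) (h : b ≤ c), (t : ℤ) ≤ ∑ j, (c j - b j) →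
    (N.map (homOfLE h)).hom y = 0}
  zero_mem' := ⟨0, fun c h _ => map_zero _⟩
  add_mem' := by
    rintro y z ⟨s, hs⟩ ⟨t, ht⟩
    refine ⟨max s t, fun c h hc => ?_⟩
    rw [map_add, hs c h (le_trans (by simp) hc), ht c h (le_trans (by simp) hc), add_zero]
  smul_mem' := by
    rintro r y ⟨s, hs⟩
    exact ⟨s, fun c h hc => by rw [map_smul, hs c h hc, smul_zero]⟩

lemma torsionPart_map (N : GrMod k n) {b c : Deg n} (h : b ⟶ c) :
    ∀ y ∈ torsionPart N b, (N.map h).hom y ∈ torsionPart N c := by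
  rintro y ⟨t, ht⟩
  refine ⟨t, fun d hd hs => ?_⟩
  rw [← LinearMap.comp_apply, ← ModuleCat.hom_comp, ← N.map_comp]
  refine ht d ((leOfHom h).trans hd) (hs.trans (Finset.sum_le_sum fun j _ => ?_))
  have : b j ≤ c j := leOfHom h j
  exact sub_le_sub_left this _

lemma torsionPart_app {N N' : GrMod k n} (f : N ⟶ N') (b : Deg n) :
    ∀ y ∈ torsionPart N b, (f.app b).hom y ∈ torsionPart N' b := by
  rintro y ⟨t, ht⟩
  refine ⟨t, fun d hd hs => ?_⟩
  rw [← LinearMap.comp_apply, ← ModuleCat.hom_comp, ← f.naturality, ModuleCat.hom_comp,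
    LinearMap.comp_apply, ht d hd hs, map_zero]

/-- The `𝔪`-torsion functor `Γ_𝔪` on `ℤⁿ`-graded `S`-modules. -/
def torsionFunctor (k : Type u) [Field k] (n : ℕ) : GrMod k n ⥤ GrMod k n where
  obj N :=
    { obj := fun b => ModuleCat.of k (torsionPart N b)
      map := fun h => ModuleCat.ofHom ((N.map h).hom.restrict (torsionPart_map N h))
      map_id := fun b => by
        ext x
        simp
      map_comp := fun g h => by
        ext x
        simp }
  map f :=
    { app := fun b => ModuleCat.ofHom ((f.app b).hom.restrict (torsionPart_app f b))
      naturality := fun b c h => by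
        ext x
        simp }
  map_id N := by
    ext b x
    simp
  map_comp f g := by
    ext b x
    simp

instance torsionFunctor_additive (k : Type u) [Field k] (n : ℕ) :
    (torsionFunctor k n).Additive where
  map_add {N N' f g} := by
    ext b x
    rfl

/-- The `ℤⁿ`-graded local cohomology module `H^i_𝔪(N)`: the `i`-th right derived functor of the
`𝔪`-torsion functor. -/
noncomputable def localCohomologyModule (i : ℕ) (N : GrMod k n) : GrMod k n :=
  ((torsionFunctor k n).rightDerived i).obj N

end Torsion

section Modules

variable {k : Type u} [Field k] {n : ℕ}
variable {M : Type u} [AddCommGroup M] [Module k M] [Module (MvPolynomial (Fin n) k) M]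
  [IsScalarTower k (MvPolynomial (Fin n) k) M]

/-- The exponent vector `c - b ∈ ℕⁿ`, for `b ≤ c` in `ℤⁿ`. -/
noncomputable def exponent (b c : Deg n) : Fin n →₀ ℕ :=
  Finsupp.equivFunOnFinite.symm fun i => (c i - b i).toNat

lemma exponent_self (b : Deg n) : exponent b b = 0 := by
  ext i
  simp [exponent]

lemma exponent_add {b c d : Deg n} (h : b ≤ c) (h' : c ≤ d) :
    exponent c d + exponent b c = exponent b d := by
  ext i
  have : b i ≤ c i := h i
  have : c i ≤ d i := h' i
  simp only [exponent, Finsupp.add_apply, Finsupp.equivFunOnFinite_symm_apply_apply]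
  omega

lemma monomial_mem_polyGrading {b c : Deg n} (h : b ≤ c) :
    MvPolynomial.monomial (exponent b c) (1 : k) ∈ polyGrading k n (fun j => c j - b j) := by
  rw [MvPolynomial.mem_weightedHomogeneousSubmodule]
  apply MvPolynomial.isWeightedHomogeneous_monomial
  funext j
  have h1 : b j ≤ c j := h j
  rw [Finsupp.weight_apply, Finsupp.sum_fintype _ _ (fun i => by simp), Finset.sum_apply,
    Finset.sum_eq_single j]
  · simp only [exponent, Finsupp.equivFunOnFinite_symm_apply_apply, Pi.smul_apply,
      Pi.single_eq_same, nsmul_eq_mul, mul_one]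
    omega
  · intro i _ hij
    simp [Pi.single_eq_of_ne' hij]
  · simp

lemma sub_vadd_degree (b c : Fin n → ℤ) : (fun j => c j - b j) +ᵥ b = c :=
  funext fun j => sub_add_cancel (c j) (b j)

variable (𝓜 : (Fin n → ℤ) → Submodule k M) [SetLike.GradedSMul (polyGrading k n) 𝓜]

/-- Multiplication by the monomial `x^{c-b}` as a map `M_b → M_c`. -/
noncomputable def mulMonomial {b c : Deg n} (h : b ≤ c) : 𝓜 b →ₗ[k] 𝓜 c where
  toFun y := ⟨MvPolynomial.monomial (exponent b c) (1 : k) • (y : M), by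
    have hy := SetLike.GradedSMul.smul_mem (B := 𝓜) (monomial_mem_polyGrading (k := k) h) y.2
    exact (congrArg (fun d => _ ∈ 𝓜 d) (sub_vadd_degree b c)).mp hy⟩
  map_add' y z := Subtype.ext (by simp [smul_add])
  map_smul' r y := Subtype.ext (by
    simp only [Submodule.coe_smul, RingHom.id_apply]
    rw [← algebraMap_smul (MvPolynomial (Fin n) k) r (y : M), smul_smul, mul_comm, ← smul_smul,
      algebraMap_smul])

/-- The `ℤⁿ`-graded module `M = ⨁ M_b` as an object of the category of `ℤⁿ`-graded modules. -/
noncomputable def ofGraded : GrMod k n where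
  obj b := ModuleCat.of k (𝓜 b)
  map h := ModuleCat.ofHom (mulMonomial 𝓜 (leOfHom h))
  map_id b := by
    ext y
    simp [mulMonomial, exponent_self]
  map_comp g h := by
    ext y
    simp [mulMonomial, smul_smul, MvPolynomial.monomial_mul,
      exponent_add (leOfHom g) (leOfHom h)]

/-- The Betti number `β_{i,b}(M) = dim_k Tor_i^S(k, M)_b`.  It is a cardinal number, so that no
junk value arises in case the dimension is infinite. -/
noncomputable def bettiNumber (i : ℕ) (b : Fin n → ℤ) : Cardinal.{u} :=
  Module.rank k ((torResidue i (ofGraded 𝓜)).obj b)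

/-- The degree `c` component `H^i_𝔪(M)_c` of the `i`-th local cohomology module of `M` with
support in `𝔪 = (x₁, …, xₙ)`. -/
noncomputable def localCohomologyPiece (i : ℕ) (c : Fin n → ℤ) : ModuleCat.{u} k :=
  (localCohomologyModule i (ofGraded 𝓜)).obj c

end Modules

end MultiGraded

/-! Fix a coordinate `j` and put `m = a j`. The key claim is that `clampCounit`, the multiplication
`N_{clamp b} → N_b` by a power of `x_j`, is an isomorphism. This is a graded Nakayama argument:
vanishing of `Tor_0` in degrees with `m < b j` means no generators there, whence surjectivity;
vanishing of `Tor_1` means no relations there, whence injectivity. Finite generation bounds the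
degrees of `N` from below, which permits induction on the degree (`isIso_clampCounit`).

Consequently `N` is its own pullback along `clamp`. This pullback is exact and preserves injectives,
so `H^i_𝔪(N)` can be computed from a pulled-back injective resolution. In its terms `x_j` acts
bijectively from degrees with `c j ≥ m`, so they have no torsion there and the cohomology vanishes
(`subsingleton_localCohomologyModule`). Letting `j` vary gives the bound. -/

namespace MultiGraded

/-! ### Truncating one coordinate of the degree -/

section Clamp

variable {n : ℕ}

/-- Truncation of the `j`-th coordinate of a degree at `m`. -/
def clamp (j : Fin n) (m : ℤ) (b : Deg n) : Deg n :=
  fun i => if i = j then min (b i) m else b i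

lemma clamp_same (j : Fin n) (m : ℤ) (b : Deg n) : clamp j m b j = min (b j) m := by
  simp [clamp]

lemma clamp_of_ne {j i : Fin n} (h : i ≠ j) (m : ℤ) (b : Deg n) : clamp j m b i = b i := by
  simp [clamp, h]

lemma clamp_le (j : Fin n) (m : ℤ) (b : Deg n) : clamp j m b ≤ b := fun i => by
  by_cases h : i = j
  · subst h; rw [clamp_same]; exact min_le_left _ _
  · rw [clamp_of_ne h]

lemma clamp_mono (j : Fin n) (m : ℤ) : Monotone (clamp (n := n) j m) := fun b c h i => by
  by_cases hi : i = j
  · subst hi; rw [clamp_same, clamp_same]; exact min_le_min_right _ (h i)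
  · rw [clamp_of_ne hi, clamp_of_ne hi]; exact h i

lemma clamp_eq_self {j : Fin n} {m : ℤ} {b : Deg n} (h : b j ≤ m) : clamp j m b = b :=
  funext fun i => by
    by_cases hi : i = j
    · subst hi; rw [clamp_same, min_eq_left h]
    · rw [clamp_of_ne hi]

lemma clamp_lt {j : Fin n} {m : ℤ} {b : Deg n} (h : m < b j) : clamp j m b < b :=
  lt_of_le_of_ne (clamp_le j m b) fun e => by
    have := congrFun e j
    rw [clamp_same, min_eq_right h.le] at this
    omega

lemma clamp_clamp (j : Fin n) (m : ℤ) (b : Deg n) : clamp j m (clamp j m b) = clamp j m b :=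
  clamp_eq_self (by rw [clamp_same]; exact min_le_right _ _)

/-- Truncation of the `j`-th coordinate, as a functor on the poset of degrees. -/
abbrev clampFunctor (j : Fin n) (m : ℤ) : Deg n ⥤ Deg n := (clamp_mono j m).functor

/-- Coordinatewise maxima stay in this comma category: the `j`-th coordinate of the maximum is one
of the two given ones. Left Kan extension along `clamp` is therefore a filtered colimit. -/
instance isFiltered_costructuredArrow_clamp (j : Fin n) (m : ℤ) (d : Deg n) :
    IsFiltered (CostructuredArrow (clampFunctor j m) d) := by
  have hle (T : CostructuredArrow (clampFunctor j m) d) : clamp j m T.left ≤ d := leOfHom T.hom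
  have : Nonempty (CostructuredArrow (clampFunctor j m) d) :=
    ⟨CostructuredArrow.mk (Y := d) (homOfLE (clamp_le j m d))⟩
  have : IsFilteredOrEmpty (CostructuredArrow (clampFunctor j m) d) :=
    { cocone_objs := fun X Y => by
        let Z : Deg n := fun i => max (X.left i) (Y.left i)
        have hZ : clamp j m Z ≤ d := fun i => by
          have hX := hle X i
          have hY := hle Y i
          by_cases hi : i = j
          · subst hi
            rw [clamp_same] at hX hY ⊢
            rcases le_total (X.left i) (Y.left i) with h | h
            · simpa only [Z, max_eq_right h] using hY
            · simpa only [Z, max_eq_left h] using hX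
          · rw [clamp_of_ne hi] at hX hY ⊢
            exact max_le hX hY
        exact ⟨CostructuredArrow.mk (Y := Z) (homOfLE hZ),
          CostructuredArrow.homMk (homOfLE fun i => le_max_left _ _) (Subsingleton.elim _ _),
          CostructuredArrow.homMk (homOfLE fun i => le_max_right _ _) (Subsingleton.elim _ _),
          trivial⟩
      cocone_maps := fun X Y f g => ⟨Y, 𝟙 Y, by ext; exact Subsingleton.elim _ _⟩ }
  exact IsFiltered.mk

end Clamp

/-! ### Local cohomology of modules pulled back along the truncation -/

section LocalCohomology

variable {k : Type u} [Field k] {n : ℕ}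

/-- The endofunctor `N ↦ (b ↦ N_{clamp b})` of the category of `ℤⁿ`-graded modules. -/
abbrev clampPullback (k : Type u) [Field k] {n : ℕ} (j : Fin n) (m : ℤ) : GrMod k n ⥤ GrMod k n :=
  (Functor.whiskeringLeft _ _ _).obj (clampFunctor j m)

/-- The multiplication maps `N_{clamp b} → N_b`. -/
def clampCounit (j : Fin n) (m : ℤ) (N : GrMod k n) : (clampPullback k j m).obj N ⟶ N where
  app b := N.map (homOfLE (clamp_le j m b))
  naturality b c h := by
    simp only [Functor.whiskeringLeft_obj_obj, Functor.comp_map, ← N.map_comp]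
    rfl

/-- Filtered colimits of vector spaces are exact, applied to the pointwise formula for the Kan
extension. -/
instance preservesMonomorphisms_lan_clamp (j : Fin n) (m : ℤ) :
    ((clampFunctor j m).lan : GrMod k n ⥤ GrMod k n).PreservesMonomorphisms where
  preserves {X Y} f hf := by
    rw [NatTrans.mono_iff_mono_app]
    intro d
    have : AB5OfSize.{0, 0} (ModuleCat.{u} k) := AB5OfSize_shrink.{0, 0, u, u} _
    have : Mono (Functor.whiskerLeft (CostructuredArrow.proj (clampFunctor j m) d) f) := by
      rw [NatTrans.mono_iff_mono_app] at hf ⊢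
      exact fun T => hf _
    refine colim.map_mono' (Functor.whiskerLeft (CostructuredArrow.proj (clampFunctor j m) d) f)
      (Functor.isPointwiseLeftKanExtensionLeftKanExtensionUnit (clampFunctor j m) X d)
      (Functor.isPointwiseLeftKanExtensionLeftKanExtensionUnit (clampFunctor j m) Y d) _ ?_
    intro T
    let g := (clampFunctor j m).lan.map f
    have h : f.app T.left ≫ ((clampFunctor j m).lanUnit.app Y).app T.left =
        ((clampFunctor j m).lanUnit.app X).app T.left ≫ g.app (clamp j m T.left) :=
      congr_app ((clampFunctor j m).lanUnit.naturality f) T.left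
    have h' : ((clampFunctor j m).lanUnit.app X).app T.left ≫
        ((clampFunctor j m).lan.obj X).map T.hom ≫ g.app d =
        f.app T.left ≫ ((clampFunctor j m).lanUnit.app Y).app T.left ≫
          ((clampFunctor j m).lan.obj Y).map T.hom := by
      rw [g.naturality, reassoc_of% h]
      rfl
    exact (Category.assoc _ _ _).trans h'

/-- A right adjoint of a functor preserving monomorphisms preserves injectives. -/
instance injective_clampPullback (j : Fin n) (m : ℤ) (I : GrMod k n) [Injective I] :
    Injective ((clampPullback k j m).obj I) :=
  ((clampFunctor j m).lanAdjunction (ModuleCat.{u} k)).map_injective _ inferInstance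

/-- The injective resolution of `N_{clamp b}` obtained from one of `N`. -/
noncomputable def clampResolution (j : Fin n) (m : ℤ) {N : GrMod k n} (I : InjectiveResolution N) :
    InjectiveResolution ((clampPullback k j m).obj N) where
  cocomplex := ((clampPullback k j m).mapHomologicalComplex _).obj I.cocomplex
  injective i := injective_clampPullback j m (I.cocomplex.X i)
  ι := (HomologicalComplex.singleMapHomologicalComplex (clampPullback k j m)
      (ComplexShape.up ℕ) 0).inv.app _ ≫ ((clampPullback k j m).mapHomologicalComplex _).map I.ι
  -- Precomposition is exact, so it preserves quasi-isomorphisms.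
  quasiIso := inferInstance

/-- Past `m` in direction `j` the truncated degree is constant, so every power of `x_j` acts
invertibly and kills only zero. -/
lemma torsionPart_clampPullback (j : Fin n) (m : ℤ) (N : GrMod k n) {c : Deg n} (hc : m ≤ c j) :
    torsionPart ((clampPullback k j m).obj N) c = ⊥ := by
  rw [eq_bot_iff]
  rintro y ⟨t, ht⟩
  -- The degree reached from `c` by multiplying by `x_j ^ t`.
  let d : Deg n := fun i => if i = j then c i + t else c i
  have hcd : c ≤ d := fun i => by
    by_cases hi : i = j
    · subst hi; simp [d]
    · simp [d, hi]
  have hclamp : clamp j m c = clamp j m d := funext fun i => by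
    by_cases hi : i = j
    · subst hi; rw [clamp_same, clamp_same]; simp [d, hc, hc.trans]
    · rw [clamp_of_ne hi, clamp_of_ne hi]; simp [d, hi]
  have hsum : (t : ℤ) ≤ ∑ i, (d i - c i) := by
    rw [Finset.sum_eq_single j (fun i _ hi => by simp [d, hi]) (by simp)]
    simp [d]
  have h := ht d hcd hsum
  have hiso : IsIso (N.map (homOfLE (clamp_mono j m hcd))) := by
    have : homOfLE (clamp_mono j m hcd) = eqToHom hclamp := Subsingleton.elim _ _
    rw [this]
    infer_instance
  exact (ModuleCat.mono_iff_injective (N.map (homOfLE (clamp_mono j m hcd)))).1 inferInstance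
    (h.trans (map_zero (N.map (homOfLE (clamp_mono j m hcd))).hom).symm)

theorem subsingleton_localCohomologyModule {j : Fin n} {m : ℤ} {N : GrMod k n}
    (hN : IsIso (clampCounit j m N)) (i : ℕ) {c : Deg n} (hc : m ≤ c j) :
    Subsingleton ((localCohomologyModule i N).obj c) := by
  let I := clampResolution j m (injectiveResolution N)
  let K := ((torsionFunctor k n).mapHomologicalComplex _).obj I.cocomplex
  have hX : IsZero ((K.X i).obj c) := by
    have : Subsingleton (torsionPart (I.cocomplex.X i) c) := by
      change Subsingleton (torsionPart ((clampPullback k j m).obj _) c)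
      rw [torsionPart_clampPullback j m _ hc]
      infer_instance
    exact ModuleCat.isZero_of_subsingleton (.of k (torsionPart (I.cocomplex.X i) c))
  have hH : IsZero (((evaluation _ _).obj c).obj (K.homology i)) :=
    .of_iso (((ShortComplex.exact_iff_isZero_homology _).1
      (ShortComplex.exact_of_isZero_X₂ ((K.sc i).map ((evaluation _ _).obj c)) hX)))
      ((K.sc i).mapHomologyIso ((evaluation _ _).obj c)).symm
  have e : localCohomologyModule i N ≅ K.homology i :=
    ((torsionFunctor k n).rightDerived i).mapIso (asIso (clampCounit j m N)).symm ≪≫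
      I.isoRightDerivedObj (torsionFunctor k n) i
  exact ModuleCat.subsingleton_of_isZero (.of_iso hH (e.app c))

end LocalCohomology

/-! ### Graded Nakayama: generators and relations -/

section Nakayama

variable {k : Type u} [Field k] {n : ℕ}

/-- The order on `ℤⁿ` is not well-founded in general, but above `L` the total degree relative to `L`
is a natural number that drops strictly. -/
lemma induction_of_lower_bound (L : Deg n) {p : Deg n → Prop} (h₀ : ∀ b, ¬ L ≤ b → p b)
    (h : ∀ b, (∀ c, c < b → p c) → p b) (b : Deg n) : p b := by
  suffices H : ∀ (t : ℕ) (b : Deg n), L ≤ b → ∑ i, (b i - L i) < t → p b by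
    by_cases hb : L ≤ b
    · exact H ((∑ i, (b i - L i)).toNat + 1) b hb (by omega)
    · exact h₀ b hb
  intro t
  induction t with
  | zero =>
    intro b hb hs
    have : 0 ≤ ∑ i, (b i - L i) := Finset.sum_nonneg fun i _ => sub_nonneg.2 (hb i)
    omega
  | succ t ih =>
    intro b _ hs
    refine h b fun c hcb => ?_
    by_cases hc : L ≤ c
    · refine ih c hc ?_
      have hlt : ∑ i, (c i - L i) < ∑ i, (b i - L i) := by
        obtain ⟨hle, i, hi⟩ := Pi.lt_def.1 (show (c : Fin n → ℤ) < b from hcb)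
        exact Finset.sum_lt_sum (fun i _ => sub_le_sub_right (hle i) _)
          ⟨i, Finset.mem_univ i, sub_lt_sub_right hi _⟩
      push_cast at hs
      omega
    · exact h₀ c hc

lemma maxIdealSMul_le {N : GrMod k n} {b : Deg n} {V : Submodule k (N.obj b)}
    (h : ∀ (c : Deg n) (hc : c < b) (y : N.obj c), (N.map (homOfLE hc.le)).hom y ∈ V) :
    maxIdealSMul N b ≤ V :=
  iSup₂_le fun c hc => by
    rintro _ ⟨y, rfl⟩
    exact h c hc y

lemma map_mem_maxIdealSMul (N : GrMod k n) {c b : Deg n} (hc : c < b) (y : N.obj c) :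
    (N.map (homOfLE hc.le)).hom y ∈ maxIdealSMul N b :=
  (le_iSup₂_of_le (f := fun (c' : Deg n) (h' : c' < b) =>
    LinearMap.range (N.map (homOfLE h'.le)).hom) c hc le_rfl) ⟨y, rfl⟩

lemma map_map_apply (N : GrMod k n) {b c d : Deg n} (f : b ⟶ c) (g : c ⟶ d) (y : N.obj b) :
    (N.map g).hom ((N.map f).hom y) = (N.map (f ≫ g)).hom y := by
  rw [N.map_comp]
  rfl

lemma app_map_apply {N N' : GrMod k n} (f : N ⟶ N') {b c : Deg n} (g : b ⟶ c) (y : N.obj b) :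
    (f.app c).hom ((N.map g).hom y) = (N'.map g).hom ((f.app b).hom y) :=
  ConcreteCategory.congr_hom (f.naturality g) y

lemma isIso_clampCounit_app {j : Fin n} {m : ℤ} (N : GrMod k n) {b : Deg n} (h : b j ≤ m) :
    IsIso ((clampCounit j m N).app b) := by
  have : (clampCounit j m N).app b = N.map (eqToHom (clamp_eq_self h)) :=
    congrArg N.map (Subsingleton.elim _ _)
  rw [this]
  exact Functor.map_isIso N _

lemma isIso_map_clamp {j : Fin n} {m : ℤ} (N : GrMod k n) (b : Deg n) :
    IsIso (((clampPullback k j m).obj N).map (homOfLE (clamp_le j m b))) := by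
  have : ((clampPullback k j m).obj N).map (homOfLE (clamp_le j m b)) =
      N.map (eqToHom (clamp_clamp j m b)) := congrArg N.map (Subsingleton.elim _ _)
  rw [this]
  exact Functor.map_isIso N _

lemma epi_clampCounit {j : Fin n} {m : ℤ} {N : GrMod k n} {L : Deg n}
    (hL : ∀ b, ¬ L ≤ b → Subsingleton (N.obj b))
    (h : ∀ b : Deg n, m < b j → maxIdealSMul N b = ⊤) : Epi (clampCounit j m N) := by
  rw [NatTrans.epi_iff_epi_app]
  refine induction_of_lower_bound L (fun b hb => ?_) fun b ih => ?_
  · have := hL b hb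
    rw [ModuleCat.epi_iff_surjective]
    exact Function.surjective_to_subsingleton _
  · by_cases hb : b j ≤ m
    · have := isIso_clampCounit_app N hb
      infer_instance
    · rw [ModuleCat.epi_iff_range_eq_top, eq_top_iff, ← h b (not_le.1 hb)]
      refine maxIdealSMul_le fun c hc y => ?_
      obtain ⟨x, rfl⟩ := (ModuleCat.epi_iff_surjective _).1 (ih c hc) y
      refine ⟨(N.map (homOfLE (clamp_mono j m hc.le))).hom x, ?_⟩
      exact (map_map_apply _ _ _ _).trans
        (map_map_apply N (homOfLE (clamp_le j m c)) (homOfLE hc.le) x).symm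

/-- Exactness of `P / 𝔪P` in degree `b`, stated on elements: a cycle modulo `𝔪P` is a boundary
modulo `𝔪P`. The resolution need not be minimal. -/
lemma exists_sub_mem_maxIdealSMul {N : GrMod k n} (P : ProjectiveResolution N) {b : Deg n}
    {i' i i'' : ℕ} (hi' : (ComplexShape.down ℕ).prev i = i')
    (hi'' : (ComplexShape.down ℕ).next i = i'')
    (h : Subsingleton ((torResidue i N).obj b)) (z : (P.complex.X i).obj b)
    (hz : ((P.complex.d i i'').app b).hom z ∈ maxIdealSMul (P.complex.X i'') b) :
    ∃ w : (P.complex.X i').obj b,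
      z - ((P.complex.d i' i).app b).hom w ∈ maxIdealSMul (P.complex.X i) b := by
  let K := ((residueTensor k n).mapHomologicalComplex _).obj P.complex
  have hH : IsZero ((K.homology i).obj b) := .of_iso (ModuleCat.isZero_of_subsingleton ((torResidue i N).obj b))
    ((P.isoLeftDerivedObj (residueTensor k n) i).symm.app b)
  have hE : ((K.sc i).map ((evaluation _ _).obj b)).Exact :=
    (ShortComplex.exact_iff_isZero_homology _).2
      (.of_iso hH ((K.sc i).mapHomologyIso ((evaluation _ _).obj b)))
  have hE' := (ShortComplex.exact_iff_of_iso (((evaluation _ _).obj b).mapShortComplex.mapIso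
    (K.isoSc' i' i i'' hi' hi''))).1 hE
  obtain ⟨w, hw⟩ := (ShortComplex.moduleCat_exact_iff _).1 hE'
    (Submodule.Quotient.mk z) ((Submodule.Quotient.mk_eq_zero _).2 hz)
  obtain ⟨w, rfl⟩ := Submodule.Quotient.mk_surjective _ w
  exact ⟨w, (Submodule.Quotient.eq _).1 hw.symm⟩

lemma maxIdealSMul_eq_top {N : GrMod k n} {b : Deg n}
    (h : Subsingleton ((torResidue 0 N).obj b)) : maxIdealSMul N b = ⊤ := by
  let P := projectiveResolution N
  let p : P.complex.X 0 ⟶ N := P.π.f 0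
  have hdp : P.complex.d 1 0 ≫ p = 0 := P.complex_d_comp_π_f_zero
  have hp : Epi (p.app b) := (NatTrans.epi_iff_epi_app p).1 (inferInstanceAs (Epi (P.π.f 0))) b
  rw [eq_top_iff]
  intro y _
  obtain ⟨z, rfl⟩ := (ModuleCat.epi_iff_surjective _).1 hp y
  -- In `down ℕ` the successor of `0` is `0` by default and `d 0 0 = 0`, so the cycle condition is
  -- vacuous.
  obtain ⟨w, hw⟩ := exists_sub_mem_maxIdealSMul P (i' := 1) (i'' := 0) (by simp) (by simp) h z
    (by simp)
  have hw' := maxIdealSMul_le_app p b hw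
  rw [Submodule.mem_comap, map_sub] at hw'
  have h0 : (p.app b).hom (((P.complex.d 1 0).app b).hom w) = 0 :=
    ConcreteCategory.congr_hom (NatTrans.congr_app hdp b) w
  rwa [h0, sub_zero] at hw'

/-- Lift `p : P₀ → N` through the epimorphism `clampCounit` to `θ`. An element of the kernel in
degree `b` comes from some `y'` in `P₀`, whose multiple `z` in degree `b` is a boundary. It suffices
to show `θ z = 0`, since the pullback identifies degrees `clamp b` and `b`. -/
lemma mono_clampCounit {j : Fin n} {m : ℤ} {N : GrMod k n} {L : Deg n}
    (hL : ∀ b, ¬ L ≤ b → Subsingleton (N.obj b)) (hepi : Epi (clampCounit j m N))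
    (h : ∀ b : Deg n, m < b j → Subsingleton ((torResidue 1 N).obj b)) :
    Mono (clampCounit j m N) := by
  let P := projectiveResolution N
  let p : P.complex.X 0 ⟶ N := P.π.f 0
  have hp : Epi p := inferInstanceAs (Epi (P.π.f 0))
  have hex : (ShortComplex.mk (P.complex.d 1 0) p P.complex_d_comp_π_f_zero).Exact := P.exact₀
  let θ : P.complex.X 0 ⟶ (clampPullback k j m).obj N := Projective.factorThru p (clampCounit j m N)
  have hθ (b : Deg n) (z : (P.complex.X 0).obj b) :
      ((clampCounit j m N).app b).hom ((θ.app b).hom z) = (p.app b).hom z :=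
    ConcreteCategory.congr_hom
      (NatTrans.congr_app (Projective.factorThru_comp p (clampCounit j m N)) b) z
  rw [NatTrans.mono_iff_mono_app]
  refine induction_of_lower_bound L (fun b hb => ?_) fun b ih => ?_
  · have := hL (clamp j m b) fun h => hb (h.trans (clamp_le j m b))
    rw [ModuleCat.mono_iff_injective]
    exact Function.injective_of_subsingleton (α := N.obj (clamp j m b)) _
  by_cases hb : b j ≤ m
  · have := isIso_clampCounit_app N hb
    infer_instance
  rw [not_le] at hb
  rw [ModuleCat.mono_iff_ker_eq_bot, eq_bot_iff]
  intro y hy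
  obtain ⟨y', rfl⟩ := (ModuleCat.epi_iff_surjective _).1
    ((NatTrans.epi_iff_epi_app p).1 hp (clamp j m b)) y
  let z : (P.complex.X 0).obj b := ((P.complex.X 0).map (homOfLE (clamp_le j m b))).hom y'
  have hpz : (p.app b).hom z = 0 := (app_map_apply p _ y').trans hy
  have hzm : z ∈ maxIdealSMul (P.complex.X 0) b := map_mem_maxIdealSMul _ (clamp_lt hb) y'
  have hexb := (ShortComplex.moduleCat_exact_iff _).1 (hex.map ((evaluation _ _).obj b))
  obtain ⟨v, hv⟩ : ∃ v : (P.complex.X 1).obj b, ((P.complex.d 1 0).app b).hom v = z :=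
    hexb z hpz
  -- Since `z` lies in `𝔪P₀`, `v` is a cycle modulo `𝔪`; vanishing of `Tor_1` moves it into `𝔪P₁`
  -- without changing its boundary `z`.
  obtain ⟨w, hw⟩ := exists_sub_mem_maxIdealSMul P (i' := 2) (i'' := 0) (by simp) (by simp)
    (h b hb) v (hv.symm ▸ hzm)
  -- `θ ∘ d` becomes zero after `clampCounit`, which is injective below `b` by induction; hence `θ ∘
  -- d` kills `(𝔪P₁)_b`.
  have hle : maxIdealSMul (P.complex.X 1) b ≤
      LinearMap.ker ((θ.app b).hom ∘ₗ ((P.complex.d 1 0).app b).hom) := by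
    refine maxIdealSMul_le fun c hc x => ?_
    have hx : (θ.app c).hom (((P.complex.d 1 0).app c).hom x) = 0 := by
      refine (ModuleCat.mono_iff_injective _).1 (ih c hc) ?_
      refine ((hθ _ _).trans ?_).trans (map_zero _).symm
      exact ConcreteCategory.congr_hom (NatTrans.congr_app P.complex_d_comp_π_f_zero c) x
    rw [LinearMap.mem_ker, LinearMap.comp_apply, app_map_apply, app_map_apply, hx, map_zero]
  have hθz : (θ.app b).hom z = 0 := by
    have h1 := hle hw
    have h2 : ((P.complex.d 1 0).app b).hom (((P.complex.d 2 1).app b).hom w) = 0 :=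
      ConcreteCategory.congr_hom (NatTrans.congr_app (P.complex.d_comp_d 2 1 0) b) w
    rwa [LinearMap.mem_ker, LinearMap.comp_apply, map_sub, h2, sub_zero, hv] at h1
  have hθy : (θ.app (clamp j m b)).hom y' = 0 := by
    have := isIso_map_clamp (j := j) (m := m) N b
    refine (ModuleCat.mono_iff_injective
      (((clampPullback k j m).obj N).map (homOfLE (clamp_le j m b)))).1 inferInstance ?_
    exact ((app_map_apply θ _ y').symm.trans hθz).trans (map_zero _).symm
  change (p.app (clamp j m b)).hom y' = 0
  rw [← hθ, hθy, map_zero]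

theorem isIso_clampCounit {j : Fin n} {m : ℤ} {N : GrMod k n} {L : Deg n}
    (hL : ∀ b, ¬ L ≤ b → Subsingleton (N.obj b))
    (h : ∀ (i : ℕ) (b : Deg n), m < b j → Subsingleton ((torResidue i N).obj b)) :
    IsIso (clampCounit j m N) := by
  have := epi_clampCounit hL fun b hb => maxIdealSMul_eq_top (h 0 b hb)
  have := mono_clampCounit hL this (h 1)
  exact isIso_of_mono_of_epi _

end Nakayama

/-! ### Lower bound on the degrees of a finitely generated module -/

section FiniteGeneration

variable {k : Type u} [Field k] {n : ℕ}
variable {M : Type u} [AddCommGroup M] [Module k M] [Module (MvPolynomial (Fin n) k) M]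
  [IsScalarTower k (MvPolynomial (Fin n) k) M]

/-- Take `L` below the degrees of all homogeneous components of a finite generating set. Monomials
only raise degrees, so the sum of the components in degrees `≥ L` is a submodule containing the
generators. -/
lemma exists_lower_bound (𝓜 : (Fin n → ℤ) → Submodule k M) [DirectSum.Decomposition 𝓜]
    [SetLike.GradedSMul (polyGrading k n) 𝓜] (hfg : Module.Finite (MvPolynomial (Fin n) k) M) :
    ∃ L : Fin n → ℤ, ∀ b, ¬ L ≤ b → Subsingleton (𝓜 b) := by
  classical
  obtain ⟨s, hs⟩ := hfg.fg_top
  let D : Finset (Fin n → ℤ) := s.biUnion fun x => (DirectSum.decompose 𝓜 x).support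
  obtain ⟨L, hL⟩ := D.bddBelow
  let V : Submodule k M := ⨆ b ∈ Set.Ici L, 𝓜 b
  have hmem {b : Fin n → ℤ} (hb : L ≤ b) {x : M} (hx : x ∈ 𝓜 b) : x ∈ V :=
    (le_iSup₂_of_le (f := fun (b : Fin n → ℤ) (_ : b ∈ Set.Ici L) => 𝓜 b) b hb le_rfl) hx
  have hmon (e : Fin n →₀ ℕ) (r : k) (x : M) (hx : x ∈ V) : MvPolynomial.monomial e r • x ∈ V := by
    let f : M →ₗ[k] M := Algebra.lsmul k k M (MvPolynomial.monomial e r)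
    suffices H : V ≤ V.comap f from H hx
    refine iSup₂_le fun b hb y hy => ?_
    have he := MvPolynomial.isWeightedHomogeneous_monomial
      (fun i : Fin n => Pi.single i (1 : ℤ)) e r rfl
    refine hmem ?_ (SetLike.GradedSMul.smul_mem (A := polyGrading k n) (B := 𝓜) he hy)
    refine (show L ≤ b from hb).trans (le_add_of_nonneg_left ?_)
    rw [Finsupp.weight_apply]
    refine Finset.sum_nonneg fun i _ => nsmul_nonneg (Pi.single_nonneg.2 zero_le_one) _
  let W : Submodule (MvPolynomial (Fin n) k) M :=
    { V with
      smul_mem' := fun p x hx => by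
        change p • x ∈ V
        rw [p.as_sum, Finset.sum_smul]
        exact Submodule.sum_mem _ fun e _ => hmon e _ x hx }
  have hW : W = ⊤ := by
    rw [eq_top_iff, ← hs, Submodule.span_le]
    intro x hx
    change x ∈ V
    rw [← DirectSum.sum_support_decompose 𝓜 x]
    exact Submodule.sum_mem _ fun b hb =>
      hmem (hL (Finset.mem_biUnion.2 ⟨x, hx, hb⟩)) (SetLike.coe_mem _)
  refine ⟨L, fun b hb => (Submodule.subsingleton_iff_eq_bot).2 (eq_bot_iff.2 fun x hx => ?_)⟩
  have hxV : x ∈ V := show x ∈ W from hW ▸ Submodule.mem_top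
  -- A component in a degree outside `Set.Ici L` is independent of those inside, which already span
  -- `M`.
  have hdisj := (DirectSum.Decomposition.isInternal 𝓜).submodule_iSupIndep.disjoint_biSup (x := b) (y := Set.Ici L) hb
  exact hdisj.le_bot ⟨hx, hxV⟩

end FiniteGeneration

end MultiGraded

theorem lemmal {k : Type u} [Field k] {n : ℕ}
    {M : Type u} [AddCommGroup M] [Module k M] [Module (MvPolynomial (Fin n) k) M]
    [IsScalarTower k (MvPolynomial (Fin n) k) M]
    (𝓜 : (Fin n → ℤ) → Submodule k M) [DirectSum.Decomposition 𝓜]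
    [SetLike.GradedSMul (MultiGraded.polyGrading k n) 𝓜]
    (hfg : Module.Finite (MvPolynomial (Fin n) k) M)
    (a : Fin n → ℤ)
    (hbetti : ∀ (i : ℕ) (b : Fin n → ℤ), MultiGraded.bettiNumber 𝓜 i b ≠ 0 → b ≤ a) :
    ∀ (i : ℕ) (c : Fin n → ℤ),
      Nontrivial (MultiGraded.localCohomologyPiece 𝓜 i c) → c ≤ a - 1 := by
  intro i c hc j
  by_contra hj
  have hj : a j ≤ c j := by
    simp only [Pi.sub_apply, Pi.one_apply] at hj
    omega
  obtain ⟨L, hL⟩ := MultiGraded.exists_lower_bound 𝓜 hfg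
  have hiso : IsIso (MultiGraded.clampCounit j (a j) (MultiGraded.ofGraded 𝓜)) :=
    MultiGraded.isIso_clampCounit (L := L) hL fun i b hb => by
      by_contra hne
      have hβ : MultiGraded.bettiNumber 𝓜 i b ≠ 0 := fun h0 => hne (rank_zero_iff.1 h0)
      exact (hbetti i b hβ j).not_gt hb
  exact not_subsingleton_iff_nontrivial.2 hc
    (MultiGraded.subsingleton_localCohomologyModule hiso i hj)
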